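/- Let $\mathcal X,\mathcal Z$ be topological spaces with $\sigma$-algebras containing their open sets, and let $\mathcal H_{\mathcal X},\mathcal H_{\mathcal Z}$ be separable real reproducing kernel Hilbert spaces on $\mathcal X,\mathcal Z$ with continuous kernels $k_{\mathcal X},k_{\mathcal Z}$ and feature maps $\psi(x)=k_{\mathcal X}(x,\cdot)$, $\phi(z)=k_{\mathcal Z}(z,\cdot)$. Write $[a\otimes b]c=a\langle b,c\rangle$. Let $P_Z$ and $\Pi$ be probability measures on $\mathcal Z$ and $g(\mathrm dx\mid z)$ a Markov kernel from $\mathcal Z$ to $\mathcal X$ (the likelihood), and let $P(\mathrm dz,\mathrm dx)=P_Z(\mathrm dz)\,g(\mathrm dx\mid z)$ and $Q(\mathrm dz,\mathrm dx)=\Pi(\mathrm dz)\,g(\mathrm dx\mid z)$. Put $$C^{(P)}_{ZZ}=\mathbb E_P[\phi(Z)\otimes\phi(Z)],\quad C^{(Q)}_{XX}=\mathbb E_Q[\psi(X)\otimes\psi(X)],\quad C^{(Q)}_{XZ}=\mathbb E_Q[\psi(X)\otimes\phi(Z)].$$ Assume: 1. $\|\phi(Z)\|\le\kappa_1<\infty$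 and $\|\psi(X)\|\le\kappa_2<\infty$ hold $P$-almost surely. 2. $\Pi\ll P_Z$, the density ratio $\mathrm d\Pi/\mathrm dP_Z$ has a version $r_0\in\mathcal H_{\mathcal Z}$, and $r_0=(C^{(P)}_{ZZ})^{\beta_1}g_1$ for some $\beta_1\in(0,1/2]$ and some $g_1\in\mathcal H_{\mathcal Z}$ with $\|g_1\|\le\zeta_1<\infty$. 3. $(z_i,x_i)_{i\ge1}$ are i.i.d. with law $P$, and $\hat m_\Pi=\hat m_{\Pi,n}\in\mathcal H_{\mathcal Z}$ are (random) estimates with $\|\hat m_\Pi-\mathbb E_\Pi[\phi(Z)]\|=O_p(n^{-\alpha_1})$ for some $\alpha_1\in(0,1/2]$. 4. $\eta=\eta_n>0$ are deterministic with $\eta_n\asymp n^{-\alpha_1/(\beta_1+1)}$. Let $\tilde r_\eta$ be the minimizer over $r\in\mathcal H_{\mathcal Z}$ of $$\tfrac12\langle r,\hat C^{(P)}_{ZZ}r\rangle-\langle r,\hat m_\Pi\rangle+\tfrac{\eta}{2}\|r\|^2,\qquad \hat C^{(P)}_{ZZ}=\frac1n\sum_{i=1}^n\phi(z_i)\otimes\phi(z_i),$$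 let $\hat r_i=\max(0,\tilde r_\eta(z_i))$, and let $$\hat C^{(Q)}_{XX}=\frac1n\sum_{i=1}^n\hat r_i\,\psi(x_i)\otimes\psi(x_i),\qquad \hat C^{(Q)}_{XZ}=\frac1n\sum_{i=1}^n\hat r_i\,\psi(x_i)\otimes\phi(z_i).$$ Then $$\|\hat C^{(Q)}_{XX}-C^{(Q)}_{XX}\|=O_p\!\left(n^{-\frac{\alpha_1\beta_1}{\beta_1+1}}\right)\quad\text{and}\quad\|\hat C^{(Q)}_{XZ}-C^{(Q)}_{XZ}\|=O_p\!\left(n^{-\frac{\alpha_1\beta_1}{\beta_1+1}}\right),$$ both in the Hilbert–Schmidt norm and in the operator norm. Here $Y_n=O_p(a_n)$ means that for every $\varepsilon>0$ there is $M>0$ with $\mathbb P(Y_n>Ma_n)\le\varepsilon$ for all sufficiently large $n$. -/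

import Mathlib

open MeasureTheory ProbabilityTheory Filter Topology InnerProductSpace
open scoped ENNReal

namespace KBR

noncomputable section

/-- The canonical feature map `x ↦ k(x, ·)` of a real-valued reproducing kernel Hilbert space. -/
def feature {S : Type*} (H : Type*) [NormedAddCommGroup H] [InnerProductSpace ℝ H]
    [CompleteSpace H] [RKHS ℝ H S ℝ] (x : S) : H :=
  RKHS.kerFun H x (1 : ℝ)

/-- The scalar reproducing kernel `k(x, y)` of a real-valued reproducing kernel Hilbert space. -/
def scalarKernel {S : Type*} (H : Type*) [NormedAddCommGroup H] [InnerProductSpace ℝ H]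
    [CompleteSpace H] [RKHS ℝ H S ℝ] (x y : S) : ℝ :=
  RKHS.kernel H x y (1 : ℝ)

/-- The (cross-)covariance operator `E_μ[f ⊗ g]`, where `(a ⊗ b) c = ⟪b, c⟫ a`. -/
def covOp {α E F : Type*} [MeasurableSpace α]
    [NormedAddCommGroup E] [InnerProductSpace ℝ E]
    [NormedAddCommGroup F] [InnerProductSpace ℝ F]
    (μ : Measure α) (f : α → E) (g : α → F) : F →L[ℝ] E :=
  ∫ w, rankOne ℝ (f w) (g w) ∂μ

/-- The weighted empirical operator `(1/n) ∑_{i < n} wᵢ aᵢ ⊗ bᵢ`. -/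
def weightedCov {E F : Type*}
    [NormedAddCommGroup E] [InnerProductSpace ℝ E]
    [NormedAddCommGroup F] [InnerProductSpace ℝ F]
    (n : ℕ) (w : ℕ → ℝ) (a : ℕ → E) (b : ℕ → F) : F →L[ℝ] E :=
  (n : ℝ)⁻¹ • ∑ i ∈ Finset.range n, w i • rankOne ℝ (a i) (b i)

/-- The spectral power `A ^ β` of a compact positive self-adjoint operator `A`, applied to `f`:
`∑_μ μ ^ β P_μ f`, where `P_μ` is the orthogonal projection onto the eigenspace `ker (A - μ)`
(the zero projection unless `μ` is an eigenvalue). -/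
def spectralPow {H : Type*} [NormedAddCommGroup H] [InnerProductSpace ℝ H] [CompleteSpace H]
    (A : H →L[ℝ] H) (β : ℝ) (f : H) : H :=
  ∑' μ : ℝ, μ ^ β • (A - μ • ContinuousLinearMap.id ℝ H).ker.starProjection f

/-- The KuLSIF objective `(1/2) ⟪r, C r⟫ - ⟪r, m⟫ + (η/2) ‖r‖²`. -/
def kulsifLoss {H : Type*} [NormedAddCommGroup H] [InnerProductSpace ℝ H]
    (C : H →L[ℝ] H) (m : H) (η : ℝ) (r : H) : ℝ :=
  1 / 2 * inner ℝ r (C r) - inner ℝ r m + η / 2 * ‖r‖ ^ 2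

/-- The untruncated KuLSIF estimator: the minimizer over the RKHS of the KuLSIF objective with
the empirical covariance operator of `z₀, …, z_{n-1}` and the estimated prior embedding `m`. -/
def kulsif {S H : Type*} [NormedAddCommGroup H] [InnerProductSpace ℝ H]
    [CompleteSpace H] [RKHS ℝ H S ℝ] (n : ℕ) (z : ℕ → S) (m : H) (η : ℝ) : H :=
  Classical.epsilon fun r : H =>
    IsMinOn (kulsifLoss (weightedCov n (fun _ => 1)
      (fun i => feature H (z i)) (fun i => feature H (z i))) m η) Set.univ r

/-- The truncated KuLSIF density ratio estimator `max (0, r̃_η(s))`. -/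
def ratioEst {S H : Type*} [NormedAddCommGroup H] [InnerProductSpace ℝ H]
    [CompleteSpace H] [RKHS ℝ H S ℝ] (n : ℕ) (z : ℕ → S) (m : H) (η : ℝ) (s : S) : ℝ :=
  max 0 (kulsif n z m η s)

/-- The Hilbert-Schmidt norm `(∑ₑ ‖A e‖²)^{1/2}`, the sum over an orthonormal (Hilbert) basis.
It is `∞` exactly when `A` is not Hilbert-Schmidt. -/
def hsNorm {E F : Type*} [NormedAddCommGroup E] [InnerProductSpace ℝ E] [CompleteSpace E]
    [NormedAddCommGroup F] [InnerProductSpace ℝ F] (A : E →L[ℝ] F) : ℝ≥0∞ :=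
  (∑' e : (exists_hilbertBasis ℝ E).choose, ‖A (e : E)‖ₑ ^ 2) ^ (1 / 2 : ℝ)

/-- `Y n = O_p(a n)`: for every `ε > 0` there is `M` such that `P(Y n > M a n) ≤ ε` for all
large `n`. -/
def IsBigOInProb {Ω : Type*} [MeasurableSpace Ω] (P : Measure Ω)
    (Y : ℕ → Ω → ℝ≥0∞) (a : ℕ → ℝ) : Prop :=
  ∀ ε : ℝ, 0 < ε → ∃ M : ℝ, 0 < M ∧ ∀ᶠ n in atTop,
    P {ω | ENNReal.ofReal (M * a n) < Y n ω} ≤ ENNReal.ofReal ε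

section WellDefined

variable {E F : Type*} [NormedAddCommGroup E] [InnerProductSpace ℝ E]
  [NormedAddCommGroup F] [InnerProductSpace ℝ F]

theorem tsum_enorm_inner_sq {ι : Type*} (b : HilbertBasis ι ℝ E) (x : E) :
    ∑' i, ‖inner ℝ (b i) x‖ₑ ^ 2 = ‖x‖ₑ ^ 2 := by
  have h := b.hasSum_inner_mul_inner x x
  have h2 : HasSum (fun i => ‖inner ℝ (b i) x‖ ^ 2) (‖x‖ ^ 2) := by
    rw [← real_inner_self_eq_norm_sq]
    refine h.congr_fun ?_
    intro i
    rw [real_inner_comm x (b i), Real.norm_eq_abs, sq_abs, sq]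
  have h3 := ENNReal.ofReal_tsum_of_nonneg (fun i => sq_nonneg ‖inner ℝ (b i) x‖) h2.summable
  rw [h2.tsum_eq] at h3
  simp only [ENNReal.ofReal_pow (norm_nonneg _), ofReal_norm] at h3
  exact h3.symm

variable [CompleteSpace E] [CompleteSpace F]

theorem tsum_enorm_sq_adjoint {ι κ : Type*} (b : HilbertBasis ι ℝ E) (c : HilbertBasis κ ℝ F)
    (A : E →L[ℝ] F) :
    ∑' i, ‖A (b i)‖ₑ ^ 2 = ∑' j, ‖ContinuousLinearMap.adjoint A (c j)‖ₑ ^ 2 := by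
  simp_rw [← tsum_enorm_inner_sq c (A _), ← tsum_enorm_inner_sq b (ContinuousLinearMap.adjoint A _)]
  rw [ENNReal.tsum_comm]
  simp_rw [ContinuousLinearMap.adjoint_inner_right, real_inner_comm]

/-- The Hilbert-Schmidt norm does not depend on the Hilbert basis. -/
theorem hsNorm_eq {ι : Type*} (b : HilbertBasis ι ℝ E) (A : E →L[ℝ] F) :
    hsNorm A = (∑' i, ‖A (b i)‖ₑ ^ 2) ^ (1 / 2 : ℝ) := by
  obtain ⟨w, c, -⟩ := exists_hilbertBasis ℝ F
  obtain ⟨d, hd⟩ := (exists_hilbertBasis ℝ E).choose_spec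
  rw [hsNorm, tsum_enorm_sq_adjoint b c, ← tsum_enorm_sq_adjoint d c, hd]

/-- For a positive operator and `η > 0` the KuLSIF objective has exactly one minimizer. -/
theorem existsUnique_isMinOn_kulsifLoss (C : E →L[ℝ] E) (hC : C.IsPositive) (m : E) {η : ℝ}
    (hη : 0 < η) : ∃! r, IsMinOn (kulsifLoss C m η) Set.univ r := by
  set T : E →L[ℝ] E := C + η • ContinuousLinearMap.id ℝ E with hT
  have hTpos : ∀ v, η * ‖v‖ * ‖v‖ ≤ inner ℝ (T v) v := by
    intro v
    have h := hC.inner_nonneg_left v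
    have h2 := real_inner_self_eq_norm_sq v
    simp only [hT, add_apply, smul_apply,
      ContinuousLinearMap.id_apply, inner_add_left, real_inner_smul_left]
    nlinarith
  have hco : IsCoercive ((innerSL ℝ : E →L[ℝ] E →L[ℝ] ℝ) ∘L T) :=
    ⟨η, hη, fun v => hTpos v⟩
  set r₀ := hco.continuousLinearEquivOfBilin.symm m with hr₀
  have hTr : T r₀ = m := by
    refine ext_inner_right ℝ fun w => ?_
    have h := hco.continuousLinearEquivOfBilin_apply r₀ w
    rw [hr₀, ContinuousLinearEquiv.apply_symm_apply] at h
    exact h.symm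
  have key : ∀ r, kulsifLoss C m η r =
      kulsifLoss C m η r₀ + 1 / 2 * inner ℝ (T (r - r₀)) (r - r₀) := by
    intro r
    have hs : inner ℝ (C r₀) r = inner ℝ (C r) r₀ := by
      rw [real_inner_comm]; exact (hC.isSymmetric r r₀).symm
    simp only [kulsifLoss, ← hTr, hT, add_apply,
      smul_apply, ContinuousLinearMap.id_apply, map_sub, inner_add_left,
      inner_add_right, inner_sub_left, inner_sub_right, real_inner_smul_left,
      real_inner_smul_right, real_inner_self_eq_norm_sq, real_inner_comm (C r) r,
      real_inner_comm (C r₀) r, real_inner_comm (C r₀) r₀, hs, real_inner_comm r₀ r]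
    ring
  refine ⟨r₀, fun r _ => ?_, fun r hr => ?_⟩
  · have h := hTpos (r - r₀)
    have h2 : 0 ≤ η * ‖r - r₀‖ * ‖r - r₀‖ := by positivity
    rw [Set.mem_ofPred_eq, key r]
    linarith
  · have h1 : kulsifLoss C m η r ≤ kulsifLoss C m η r₀ := hr (Set.mem_univ r₀)
    have h := hTpos (r - r₀)
    rw [key r] at h1
    have h3 : η * (‖r - r₀‖ * ‖r - r₀‖) ≤ 0 := by linarith
    have h4 : ‖r - r₀‖ * ‖r - r₀‖ ≤ 0 := nonpos_of_mul_nonpos_right h3 hη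
    have h5 : ‖r - r₀‖ = 0 := mul_self_eq_zero.1 (le_antisymm h4 (mul_self_nonneg _))
    exact sub_eq_zero.1 (norm_eq_zero.1 h5)

/-- The power acts on eigenvectors as it should. -/
theorem spectralPow_eigenvector (A : E →L[ℝ] E) (hA : (A : E →ₗ[ℝ] E).IsSymmetric) (β μ : ℝ) (f : E)
    (hf : A f = μ • f) : spectralPow A β f = μ ^ β • f := by
  rw [spectralPow, tsum_eq_single μ]
  · rw [Submodule.starProjection_eq_self_iff.2]
    simp [hf]
  · intro ν hν
    rw [(Submodule.starProjection_apply_eq_zero_iff _).2, smul_zero]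
    rw [Submodule.mem_orthogonal]
    intro u hu
    have hu' : A u = ν • u := by simpa [sub_eq_zero] using hu
    have h := hA u f
    simp only [ContinuousLinearMap.coe_coe, hu', hf, real_inner_smul_left,
      real_inner_smul_right] at h
    have : (ν - μ) * inner ℝ u f = 0 := by linarith
    exact (mul_eq_zero.1 this).resolve_left (sub_ne_zero.2 hν)

end WellDefined

end

end KBR

/-! Write `C` for the covariance of `φ(Z)` under `P`, `Ĉ` for its empirical version, `m` for the
prior embedding and `r̃` for the untruncated estimator. As `r₀` is the density ratio, `C r₀ = m`,
and the normal equation gives `(Ĉ + η) r̃ = m̂`. With `r_η = (C + η)⁻¹ C r₀`, `r̃ - r₀ = (Ĉ + η)⁻¹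
[(m̂ - m) - (Ĉ - C) r_η] + (r_η - r₀)`. Positivity bounds the resolvent by `η⁻¹`, and the source
condition bounds the bias `r_η - r₀` by `η ^ β ‖g‖` (`norm_sub_le_of_source`). Since `Ĉ - C = O_p(n
^ (-1/2))` is no larger than the error of `m̂`, the total is of order `η⁻¹ n ^ (-α) + η ^ β`; the
prescribed `η` makes both terms `n ^ (-αβ/(β+1))` (`IsBigOInProb.kulsif_rate`).

For the covariance operators, insert the empirical operator weighted by the true `r₀(zᵢ)`. Changing
weights costs at most a constant times `‖r̃ - r₀‖`, by the reproducing property and because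
truncation at zero cannot increase the distance to a nonnegative number. What remains is an i.i.d.
average whose mean, by change of measure, is the operator under `Q`;
`isBigOInProb_hsNorm_weightedCov_sub` bounds it by a second-moment computation. All estimates are in
Hilbert-Schmidt norm, which dominates the operator norm. -/

namespace KBR

/-! ### Hilbert-Schmidt norm -/

section HilbertSchmidt

variable {E F : Type*} [NormedAddCommGroup E] [InnerProductSpace ℝ E]
  [NormedAddCommGroup F] [InnerProductSpace ℝ F]

/-- Distinct basis vectors are `√2` apart, so balls of radius `1/2` around them are disjoint.
Countability later permits exchanging basis sums with integrals. -/
theorem HilbertBasis.countable_index [TopologicalSpace.SeparableSpace E] {ι : Type*}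
    (b : HilbertBasis ι ℝ E) : Countable ι := by
  refine Pairwise.countable_of_isOpen_disjoint (s := fun i => Metric.ball (b i) (1 / 2)) ?_
    (fun _ => Metric.isOpen_ball) (fun i => ⟨b i, Metric.mem_ball_self (by norm_num)⟩)
  intro i j hij
  refine Metric.ball_disjoint_ball ?_
  have h1 : ‖b i - b j‖ ^ 2 = 2 := by
    rw [@norm_sub_sq_real, b.orthonormal.1 i, b.orthonormal.1 j, b.orthonormal.2 hij]
    norm_num
  rw [dist_eq_norm]
  nlinarith [norm_nonneg (b i - b j)]

variable [CompleteSpace E]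

theorem hsNorm_sq {ι : Type*} (b : HilbertBasis ι ℝ E) (A : E →L[ℝ] F) [CompleteSpace F] :
    hsNorm A ^ 2 = ∑' i, ‖A (b i)‖ₑ ^ 2 := by
  rw [hsNorm_eq b, ← ENNReal.rpow_natCast, ← ENNReal.rpow_mul]
  norm_num

theorem hsNorm_eq_lintegral (A : E →L[ℝ] F) :
    hsNorm A = (@lintegral (exists_hilbertBasis ℝ E).choose ⊤ (@Measure.count _ ⊤)
      fun e => ‖A (e : E)‖ₑ ^ (2 : ℝ)) ^ (1 / 2 : ℝ) := by
  let _ : MeasurableSpace (exists_hilbertBasis ℝ E).choose := ⊤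
  rw [lintegral_count]
  simp [hsNorm]

/-- Minkowski's inequality in `L²` of the counting measure on the basis. -/
theorem hsNorm_add_le (A B : E →L[ℝ] F) : hsNorm (A + B) ≤ hsNorm A + hsNorm B := by
  let _ : MeasurableSpace (exists_hilbertBasis ℝ E).choose := ⊤
  simp only [hsNorm_eq_lintegral]
  refine le_trans ?_ (ENNReal.lintegral_Lp_add_le
    (f := fun e : (exists_hilbertBasis ℝ E).choose => ‖A (e : E)‖ₑ)
    (g := fun e : (exists_hilbertBasis ℝ E).choose => ‖B (e : E)‖ₑ)
    measurable_from_top.aemeasurable measurable_from_top.aemeasurable (by norm_num : (1 : ℝ) ≤ 2))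
  gcongr with e
  exact enorm_add_le _ _

theorem hsNorm_smul (c : ℝ) (A : E →L[ℝ] F) : hsNorm (c • A) = ‖c‖ₑ * hsNorm A := by
  simp only [hsNorm, smul_apply, enorm_smul, mul_pow, ENNReal.tsum_mul_left]
  rw [ENNReal.mul_rpow_of_nonneg _ _ (by norm_num), ← ENNReal.rpow_natCast, ← ENNReal.rpow_mul]
  norm_num

theorem hsNorm_zero : hsNorm (0 : E →L[ℝ] F) = 0 := by
  simpa using hsNorm_smul (0 : ℝ) (0 : E →L[ℝ] F)

theorem hsNorm_sum_le {ι : Type*} (s : Finset ι) (A : ι → E →L[ℝ] F) :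
    hsNorm (∑ i ∈ s, A i) ≤ ∑ i ∈ s, hsNorm (A i) := by
  classical
  induction s using Finset.induction_on with
  | empty => simp [hsNorm_zero]
  | insert i s hi ih =>
    rw [Finset.sum_insert hi, Finset.sum_insert hi]
    exact (hsNorm_add_le _ _).trans (by gcongr)

theorem hsNorm_rankOne [CompleteSpace F] (a : F) (b : E) :
    hsNorm (rankOne ℝ a b) = ‖a‖ₑ * ‖b‖ₑ := by
  obtain ⟨w, c, -⟩ := exists_hilbertBasis ℝ E
  refine (ENNReal.pow_right_strictMono (n := 2) (by norm_num)).injective ?_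
  simp only [hsNorm_sq c, rankOne_apply, enorm_smul, mul_pow, ENNReal.tsum_mul_right,
    real_inner_comm _ b]
  rw [← tsum_enorm_inner_sq c b, mul_comm]

/-- Expand `‖A x‖²` in a basis of the target, move `A` to its adjoint and apply Cauchy-Schwarz to
each coefficient. -/
theorem enorm_le_hsNorm [CompleteSpace F] (A : E →L[ℝ] F) : ‖A‖ₑ ≤ hsNorm A := by
  refine A.opENorm_le_bound fun x => ?_
  obtain ⟨w, b, -⟩ := exists_hilbertBasis ℝ E
  obtain ⟨v, c, -⟩ := exists_hilbertBasis ℝ F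
  refine (ENNReal.pow_right_strictMono (n := 2) (by norm_num)).le_iff_le.1 ?_
  rw [mul_pow, hsNorm_sq b, tsum_enorm_sq_adjoint b c, ← tsum_enorm_inner_sq c,
    ← ENNReal.tsum_mul_right]
  refine ENNReal.tsum_le_tsum fun j => ?_
  rw [← ContinuousLinearMap.adjoint_inner_left, ← mul_pow]
  gcongr
  rw [enorm_eq_nnnorm, enorm_eq_nnnorm, enorm_eq_nnnorm]
  exact_mod_cast nnnorm_inner_le_nnnorm _ _

theorem hsNorm_weightedCov_le [CompleteSpace F] (n : ℕ) (w : ℕ → ℝ) (a : ℕ → F) (b : ℕ → E)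
    (K : ℝ≥0∞) (h : ∀ i < n, ‖w i‖ₑ * (‖a i‖ₑ * ‖b i‖ₑ) ≤ K) :
    hsNorm (weightedCov n w a b) ≤ K := by
  rw [weightedCov, hsNorm_smul]
  have h1 : hsNorm (∑ i ∈ Finset.range n, w i • rankOne ℝ (a i) (b i)) ≤ n * K := by
    refine (hsNorm_sum_le _ _).trans ?_
    calc _ ≤ ∑ i ∈ Finset.range n, K := by
          refine Finset.sum_le_sum fun i hi => ?_
          rw [hsNorm_smul, hsNorm_rankOne]
          exact h i (Finset.mem_range.1 hi)
      _ = n * K := by simp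
  refine (mul_le_mul_right h1 _).trans ?_
  rw [← mul_assoc]
  rcases Nat.eq_zero_or_pos n with rfl | hn
  · simp
  · have : ‖(n : ℝ)⁻¹‖ₑ * (n : ℝ≥0∞) = 1 := by
      rw [enorm_inv (by positivity), ← Nat.cast_one (R := ℝ≥0∞)]
      rw [show ‖(n : ℝ)‖ₑ = (n : ℝ≥0∞) by simp]
      rw [ENNReal.inv_mul_cancel (by simp; omega) (by simp)]
      simp
    rw [this, one_mul]

end HilbertSchmidt

/-! ### Calculus of stochastic order bounds -/

section BigOInProb

variable {Ω : Type*} [MeasurableSpace Ω] {P : Measure Ω} {Y Y' : ℕ → Ω → ℝ≥0∞} {a a' : ℕ → ℝ}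

/-- Only monotonicity of the outer measure is used, so estimators that are not known to be
measurable are covered. -/
theorem IsBigOInProb.mono (h : IsBigOInProb P Y a)
    (hle : ∀ᶠ n in atTop, ∀ᵐ ω ∂P, Y' n ω ≤ Y n ω) : IsBigOInProb P Y' a := by
  intro ε hε
  obtain ⟨M, hM, h⟩ := h ε hε
  refine ⟨M, hM, ?_⟩
  filter_upwards [h, hle] with n hn hle
  refine (measure_mono_ae ?_).trans hn
  filter_upwards [hle] with ω hω h'
  exact lt_of_lt_of_le h' hω

theorem IsBigOInProb.mono_rate (h : IsBigOInProb P Y a) {K : ℝ} (hK : 0 < K)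
    (hle : ∀ᶠ n in atTop, a n ≤ K * a' n) : IsBigOInProb P Y a' := by
  intro ε hε
  obtain ⟨M, hM, h⟩ := h ε hε
  refine ⟨M * K, by positivity, ?_⟩
  filter_upwards [h, hle] with n hn hle
  refine (measure_mono ?_).trans hn
  intro ω hω
  refine lt_of_le_of_lt (ENNReal.ofReal_le_ofReal ?_) hω
  rw [mul_assoc]
  gcongr

theorem IsBigOInProb.add (h : IsBigOInProb P Y a) (h' : IsBigOInProb P Y' a)
    (ha : ∀ᶠ n in atTop, 0 ≤ a n) : IsBigOInProb P (fun n ω => Y n ω + Y' n ω) a := by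
  intro ε hε
  obtain ⟨M, hM, h⟩ := h (ε / 2) (by positivity)
  obtain ⟨M', hM', h'⟩ := h' (ε / 2) (by positivity)
  refine ⟨M + M', by positivity, ?_⟩
  filter_upwards [h, h', ha] with n hn hn' ha
  have hsub : {ω | ENNReal.ofReal ((M + M') * a n) < Y n ω + Y' n ω} ⊆
      {ω | ENNReal.ofReal (M * a n) < Y n ω} ∪ {ω | ENNReal.ofReal (M' * a n) < Y' n ω} := by
    intro ω hω
    by_contra hc
    simp only [Set.mem_union, Set.mem_ofPred_eq, not_or, not_lt] at hc hω
    rw [add_mul, ENNReal.ofReal_add (by positivity) (by positivity)] at hω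
    exact absurd hω (not_lt.2 (add_le_add hc.1 hc.2))
  calc _ ≤ _ := measure_mono hsub
    _ ≤ _ := measure_union_le _ _
    _ ≤ ENNReal.ofReal (ε / 2) + ENNReal.ofReal (ε / 2) := add_le_add hn hn'
    _ = ENNReal.ofReal ε := by
      rw [← ENNReal.ofReal_add (by positivity) (by positivity)]
      simp

theorem IsBigOInProb.ofReal_mul (h : IsBigOInProb P Y a) {c : ℕ → ℝ}
    (hc : ∀ᶠ n in atTop, 0 < c n) :
    IsBigOInProb P (fun n ω => ENNReal.ofReal (c n) * Y n ω) (fun n => c n * a n) := by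
  intro ε hε
  obtain ⟨M, hM, h⟩ := h ε hε
  refine ⟨M, hM, ?_⟩
  filter_upwards [h, hc] with n hn hc
  refine (measure_mono ?_).trans hn
  intro ω hω
  have hω' : ENNReal.ofReal (M * (c n * a n)) < ENNReal.ofReal (c n) * Y n ω := hω
  by_contra hle
  rw [Set.mem_ofPred_eq, not_lt] at hle
  refine absurd hω' (not_lt.2 ?_)
  rw [mul_left_comm, ENNReal.ofReal_mul hc.le]
  gcongr

theorem IsBigOInProb.const (c : ℕ → ℝ) : IsBigOInProb P (fun n _ => ENNReal.ofReal (c n)) c := by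
  intro ε hε
  refine ⟨1, one_pos, Eventually.of_forall fun n => ?_⟩
  simp

/-- Markov's inequality applied to the square. -/
theorem IsBigOInProb.of_lintegral_sq (hY : ∀ n, AEMeasurable (Y n) P) {K : ℝ}
    (ha : ∀ᶠ n in atTop, 0 < a n)
    (h : ∀ᶠ n in atTop, ∫⁻ ω, Y n ω ^ 2 ∂P ≤ ENNReal.ofReal (K * a n ^ 2)) :
    IsBigOInProb P Y a := by
  intro ε hε
  -- Chosen so that `K / M ^ 2 ≤ ε`; the `+ 1` keeps `M` positive when `K = 0`.
  refine ⟨√(|K| / ε + 1), by positivity, ?_⟩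
  filter_upwards [ha, h] with n ha h
  set M := √(|K| / ε + 1) with hM
  have hMpos : 0 < M := by positivity
  have hM2 : M ^ 2 = |K| / ε + 1 := Real.sq_sqrt (by positivity)
  have hpos : 0 < (M * a n) ^ 2 := by positivity
  have h1 := mul_meas_ge_le_lintegral₀ ((hY n).pow_const 2) (ENNReal.ofReal ((M * a n) ^ 2))
  have h2 : {ω | ENNReal.ofReal (M * a n) < Y n ω} ⊆
      {ω | ENNReal.ofReal ((M * a n) ^ 2) ≤ Y n ω ^ 2} := by
    intro ω hω
    rw [Set.mem_ofPred_eq, ENNReal.ofReal_pow (by positivity)]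
    exact pow_le_pow_left' (le_of_lt hω) 2
  refine (measure_mono h2).trans ?_
  have h3 := h1.trans h
  rw [mul_comm, ← ENNReal.le_div_iff_mul_le (Or.inl (ENNReal.ofReal_pos.2 hpos).ne') (Or.inl (by simp)),
    ← ENNReal.ofReal_div_of_pos hpos] at h3
  refine h3.trans (ENNReal.ofReal_le_ofReal ?_)
  rw [div_le_iff₀ hpos, mul_pow, hM2]
  have : |K| ≤ ε * (|K| / ε + 1) := by
    field_simp
    linarith
  nlinarith [le_abs_self K, sq_nonneg (a n)]

end BigOInProb

end KBR

namespace KBR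

/-! ### Regularized linear equations -/

section Resolvent

variable {E : Type*} [NormedAddCommGroup E] [InnerProductSpace ℝ E] {C : E →L[ℝ] E} {η : ℝ}

/-- Pair `(C + η) v` with `v`. For `η > 0` this is the resolvent bound `‖(C + η)⁻¹‖ ≤ η⁻¹`, stated
without an inverse. -/
theorem mul_norm_le_norm_add_smul (hC : C.IsPositive) (v : E) :
    η * ‖v‖ ≤ ‖C v + η • v‖ := by
  have h1 : η * ‖v‖ * ‖v‖ ≤ inner ℝ (C v + η • v) v := by
    have h := hC.inner_nonneg_left v
    rw [inner_add_left, real_inner_smul_left, real_inner_self_eq_norm_sq]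
    nlinarith
  have h2 := real_inner_le_norm (C v + η • v) v
  rcases (norm_nonneg v).eq_or_lt with h | h
  · rw [← h, mul_zero]
    exact norm_nonneg _
  · exact le_of_mul_le_mul_right (h1.trans h2) h

theorem isMinOn_kulsifLoss_of_add_smul_eq (hC : C.IsPositive) (hη : 0 < η) {m r₀ : E}
    (h₀ : C r₀ + η • r₀ = m) : IsMinOn (kulsifLoss C m η) Set.univ r₀ := by
  intro r _
  have h1 := hC.inner_nonneg_left (r - r₀)
  have h2 := mul_nonneg hη.le (sq_nonneg ‖r - r₀‖)
  have hs : inner ℝ (C r₀) r = inner ℝ (C r) r₀ := by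
    rw [real_inner_comm]; exact (hC.isSymmetric r r₀).symm
  rw [← real_inner_self_eq_norm_sq] at h2
  simp only [map_sub, inner_sub_left, inner_sub_right, real_inner_comm r₀ r] at h1 h2
  simp only [Set.mem_ofPred_eq, kulsifLoss, ← h₀, inner_add_right, real_inner_smul_right,
    ← real_inner_self_eq_norm_sq, real_inner_comm (C r) r, real_inner_comm (C r₀) r,
    real_inner_comm (C r₀) r₀, real_inner_comm r₀ r]
  nlinarith

variable [CompleteSpace E]

theorem exists_add_smul_eq (hC : C.IsPositive) (hη : 0 < η) (m : E) :
    ∃ r, C r + η • r = m := by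
  have hco : IsCoercive ((innerSL ℝ : E →L[ℝ] E →L[ℝ] ℝ) ∘L
      (C + η • ContinuousLinearMap.id ℝ E)) := by
    refine ⟨η, hη, fun v => ?_⟩
    have h := hC.inner_nonneg_left v
    have h2 := real_inner_self_eq_norm_sq v
    change η * ‖v‖ * ‖v‖ ≤ inner ℝ (C v + η • v) v
    rw [inner_add_left, real_inner_smul_left]
    nlinarith
  refine ⟨hco.continuousLinearEquivOfBilin.symm m, ext_inner_right ℝ fun w => ?_⟩
  have h := hco.continuousLinearEquivOfBilin_apply (hco.continuousLinearEquivOfBilin.symm m) w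
  rw [ContinuousLinearEquiv.apply_symm_apply] at h
  exact h.symm

/-- No differentiation is needed: Lax-Milgram supplies a solution of the normal equation, completing
the square shows that it minimizes, and the minimizer is unique. -/
theorem add_smul_eq_of_isMinOn_kulsifLoss (hC : C.IsPositive) (hη : 0 < η) {m r : E}
    (h : IsMinOn (kulsifLoss C m η) Set.univ r) : C r + η • r = m := by
  obtain ⟨r₀, h₀⟩ := exists_add_smul_eq hC hη m
  rwa [(existsUnique_isMinOn_kulsifLoss C hC m hη).unique h
    (isMinOn_kulsifLoss_of_add_smul_eq hC hη h₀)]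

end Resolvent

/-! ### Spectral powers and regularization bias -/

section SpectralPower

variable {E : Type*} [NormedAddCommGroup E] [InnerProductSpace ℝ E] [CompleteSpace E]
  {C : E →L[ℝ] E} {η : ℝ}

/-- The orthogonal projection onto the eigenspace `ker (C - μ)`. -/
noncomputable def eigenProj (C : E →L[ℝ] E) (μ : ℝ) : E →L[ℝ] E :=
  (C - μ • ContinuousLinearMap.id ℝ E).ker.starProjection

theorem apply_eigenProj (C : E →L[ℝ] E) (μ : ℝ) (g : E) :
    C (eigenProj C μ g) = μ • eigenProj C μ g := by
  have h : (C - μ • ContinuousLinearMap.id ℝ E) (eigenProj C μ g) = 0 :=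
    LinearMap.mem_ker.1 (Submodule.starProjection_apply_mem (C - μ • ContinuousLinearMap.id ℝ E).ker g)
  exact sub_eq_zero.1 h

theorem inner_eigenProj_self (C : E →L[ℝ] E) (μ : ℝ) (g : E) :
    inner ℝ (eigenProj C μ g) g = ‖eigenProj C μ g‖ ^ 2 := by
  exact Submodule.re_inner_starProjection_eq_normSq
    (C - μ • ContinuousLinearMap.id ℝ E).ker g

theorem inner_eigenProj_of_ne (hC : C.IsPositive) {μ ν : ℝ} (h : μ ≠ ν) (g : E) :
    inner ℝ (eigenProj C μ g) (eigenProj C ν g) = 0 := by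
  have h1 := hC.isSymmetric (eigenProj C μ g) (eigenProj C ν g)
  simp only [ContinuousLinearMap.coe_coe, apply_eigenProj, real_inner_smul_left,
    real_inner_smul_right] at h1
  have : (μ - ν) * inner ℝ (eigenProj C μ g) (eigenProj C ν g) = 0 := by linarith
  exact (mul_eq_zero.1 this).resolve_left (sub_ne_zero.2 h)

theorem eigenProj_eq_zero_of_neg (hC : C.IsPositive) {μ : ℝ} (h : μ < 0) (g : E) :
    eigenProj C μ g = 0 := by
  have h1 := hC.inner_nonneg_left (eigenProj C μ g)
  rw [apply_eigenProj, real_inner_smul_left, real_inner_self_eq_norm_sq] at h1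
  have h2 : ‖eigenProj C μ g‖ ^ 2 ≤ 0 := by
    by_contra hc
    nlinarith [not_le.1 hc]
  simpa using le_antisymm h2 (sq_nonneg _)

theorem norm_sum_smul_eigenProj_sq (hC : C.IsPositive) (s : Finset ℝ) (c : ℝ → ℝ) (g : E) :
    ‖∑ μ ∈ s, c μ • eigenProj C μ g‖ ^ 2 = ∑ μ ∈ s, c μ ^ 2 * ‖eigenProj C μ g‖ ^ 2 := by
  rw [← real_inner_self_eq_norm_sq, sum_inner]
  refine Finset.sum_congr rfl fun μ hμ => ?_
  rw [inner_sum, Finset.sum_eq_single μ]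
  · rw [real_inner_smul_left, real_inner_smul_right, real_inner_self_eq_norm_sq]
    ring
  · intro ν _ hν
    rw [real_inner_smul_left, real_inner_smul_right, inner_eigenProj_of_ne hC hν.symm]
    simp
  · intro h
    exact absurd hμ h

/-- Bessel's inequality: the squared norm of the projected sum equals its inner product with `g`. -/
theorem sum_norm_eigenProj_sq_le (hC : C.IsPositive) (s : Finset ℝ) (g : E) :
    ∑ μ ∈ s, ‖eigenProj C μ g‖ ^ 2 ≤ ‖g‖ ^ 2 := by
  have h1 := norm_sum_smul_eigenProj_sq hC s (fun _ => 1) g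
  simp only [one_smul, one_pow, one_mul] at h1
  have h2 : inner ℝ (∑ μ ∈ s, eigenProj C μ g) g = ∑ μ ∈ s, ‖eigenProj C μ g‖ ^ 2 := by
    rw [sum_inner]
    exact Finset.sum_congr rfl fun μ _ => inner_eigenProj_self C μ g
  have h3 := real_inner_le_norm (∑ μ ∈ s, eigenProj C μ g) g
  rw [h2, ← h1] at h3
  rw [← h1]
  nlinarith [norm_nonneg g, norm_nonneg (∑ μ ∈ s, eigenProj C μ g),
    sq_nonneg (‖∑ μ ∈ s, eigenProj C μ g‖ - ‖g‖)]

theorem norm_sum_smul_eigenProj_le (hC : C.IsPositive) (s : Finset ℝ) (c : ℝ → ℝ) (g : E)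
    {K : ℝ} (hK : 0 ≤ K) (hc : ∀ μ, 0 ≤ μ → |c μ| ≤ K) :
    ‖∑ μ ∈ s, c μ • eigenProj C μ g‖ ≤ K * ‖g‖ := by
  refine le_of_sq_le_sq ?_ (by positivity)
  rw [norm_sum_smul_eigenProj_sq hC, mul_pow]
  refine le_trans ?_ (mul_le_mul_of_nonneg_left (sum_norm_eigenProj_sq_le hC s g) (sq_nonneg K))
  rw [Finset.mul_sum]
  refine Finset.sum_le_sum fun μ _ => ?_
  rcases lt_or_ge μ 0 with h | h
  · simp [eigenProj_eq_zero_of_neg hC h]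
  · have : c μ ^ 2 ≤ K ^ 2 := sq_le_sq.2 ((hc μ h).trans (le_abs_self K))
    gcongr

/-- Weighted AM-GM gives `η ^ (1 - β) μ ^ β ≤ (1 - β) η + β μ ≤ μ + η`. This is the scalar form of
the bias bound. -/
theorem mul_rpow_div_add_le {μ β : ℝ} (hμ : 0 ≤ μ) (hη : 0 < η) (hβ : 0 ≤ β) (hβ' : β ≤ 1) :
    |η * μ ^ β / (μ + η)| ≤ η ^ β := by
  rw [abs_of_nonneg (by positivity), div_le_iff₀ (by positivity)]
  have h := Real.geom_mean_le_arith_mean2_weighted (sub_nonneg.2 hβ') hβ hη.le hμ (by ring)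
  have h2 : η = η ^ β * η ^ (1 - β) := by
    rw [← Real.rpow_add hη]
    simp
  have h3 : η ^ (1 - β) * μ ^ β ≤ μ + η := by nlinarith
  calc η * μ ^ β = η ^ β * (η ^ (1 - β) * μ ^ β) := by
        conv_lhs => rw [h2]
        ring
    _ ≤ _ := by gcongr

/-- The regularization bias under the source condition `f = C ^ β g`:
`‖η (C + η)⁻¹ C ^ β g‖ ≤ η ^ β ‖g‖`. -/
theorem norm_le_of_add_smul_eq_smul_spectralPow (hC : C.IsPositive) (hη : 0 < η) {β : ℝ}
    (hβ : 0 ≤ β) (hβ' : β ≤ 1) {g d : E} (hd : C d + η • d = η • spectralPow C β g) :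
    ‖d‖ ≤ η ^ β * ‖g‖ := by
  by_cases hs : Summable fun μ : ℝ => μ ^ β • eigenProj C μ g
  · have hf : HasSum (fun μ : ℝ => μ ^ β • eigenProj C μ g) (spectralPow C β g) := hs.hasSum
    -- Finite spectral truncations of `d`: each solves the equation with a truncated right-hand
    -- side, so the resolvent bound forces `D s → d`.
    let D : Finset ℝ → E := fun s => ∑ μ ∈ s, (η * μ ^ β / (μ + η)) • eigenProj C μ g
    have hD : ∀ s, C (D s) + η • D s = η • ∑ μ ∈ s, μ ^ β • eigenProj C μ g := by
      intro s
      simp only [D, map_sum, Finset.smul_sum, ← Finset.sum_add_distrib, map_smul,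
        apply_eigenProj, smul_smul, ← add_smul]
      refine Finset.sum_congr rfl fun μ _ => ?_
      -- For negative `μ` the denominator `μ + η` may vanish, but then the projection is zero.
      rcases lt_or_ge μ 0 with h | h
      · simp [eigenProj_eq_zero_of_neg hC h]
      · congr 1
        field_simp
    have hlim : Tendsto D atTop (𝓝 d) := by
      rw [tendsto_iff_norm_sub_tendsto_zero]
      refine squeeze_zero (fun _ => norm_nonneg _)
        (g := fun s => ‖(∑ μ ∈ s, μ ^ β • eigenProj C μ g) - spectralPow C β g‖) (fun s => ?_)
        (tendsto_iff_norm_sub_tendsto_zero.1 hf)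
      have h := mul_norm_le_norm_add_smul (η := η) hC (D s - d)
      rw [map_sub, smul_sub, sub_add_sub_comm, hD, hd, ← smul_sub, norm_smul,
        Real.norm_of_nonneg hη.le] at h
      exact le_of_mul_le_mul_left h hη
    refine le_of_tendsto hlim.norm (Eventually.of_forall fun s => ?_)
    exact norm_sum_smul_eigenProj_le hC s _ g (by positivity)
      fun μ hμ => mul_rpow_div_add_le hμ hη hβ hβ'
  -- If the series is not summable, `tsum` defaults to zero and `d = 0`. Hence compactness of `C`
  -- never has to be proved.
  · have h0 : spectralPow C β g = 0 := tsum_eq_zero_of_not_summable hs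
    have h := mul_norm_le_norm_add_smul (η := η) hC d
    rw [hd, h0, smul_zero, norm_zero] at h
    have : ‖d‖ ≤ 0 := by
      by_contra hc
      nlinarith [not_le.1 hc]
    exact this.trans (by positivity)

end SpectralPower

/-- The deterministic error bound for the regularized solution `(A + η)⁻¹ m'` of a perturbation of
`C r₀ = m` under the source condition `r₀ = C ^ β g`. -/
theorem norm_sub_le_of_source {E : Type*} [NormedAddCommGroup E] [InnerProductSpace ℝ E]
    [CompleteSpace E] {A C : E →L[ℝ] E} {η β : ℝ} (hA : A.IsPositive) (hC : C.IsPositive)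
    (hη : 0 < η) (hβ : 0 ≤ β) (hβ' : β ≤ 1) {g r r₀ m' : E} (hr₀ : r₀ = spectralPow C β g)
    (hr : A r + η • r = m') :
    ‖r - r₀‖ ≤ η⁻¹ * (‖m' - C r₀‖ + 2 * ‖r₀‖ * ‖A - C‖) + η ^ β * ‖g‖ := by
  -- `d = η (C + η)⁻¹ r₀` is the bias, so `r₀ - d` is the population regularized solution.
  obtain ⟨d, hd⟩ := exists_add_smul_eq hC hη (η • r₀)
  have hd1 : ‖d‖ ≤ η ^ β * ‖g‖ :=
    norm_le_of_add_smul_eq_smul_spectralPow hC hη hβ hβ' (hr₀ ▸ hd)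
  have hd2 : ‖d‖ ≤ ‖r₀‖ := by
    have h := mul_norm_le_norm_add_smul (η := η) hC d
    rw [hd, norm_smul, Real.norm_of_nonneg hη.le] at h
    exact le_of_mul_le_mul_left h hη
  have h1 : A (r - (r₀ - d)) + η • (r - (r₀ - d)) = (m' - C r₀) - (A - C) (r₀ - d) := by
    have hCd : C d = η • r₀ - η • d := by rw [← hd]; abel
    simp only [map_sub, sub_apply, ← hr, smul_sub, hCd]
    abel
  have h2 := mul_norm_le_norm_add_smul (η := η) hA (r - (r₀ - d))
  rw [h1] at h2
  have h3 : ‖r₀ - d‖ ≤ 2 * ‖r₀‖ := (norm_sub_le _ _).trans (by linarith)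
  have h4 : ‖(A - C) (r₀ - d)‖ ≤ 2 * ‖r₀‖ * ‖A - C‖ :=
    ((A - C).le_opNorm _).trans (by rw [mul_comm]; gcongr)
  have h5 : ‖r - (r₀ - d)‖ ≤ η⁻¹ * (‖m' - C r₀‖ + 2 * ‖r₀‖ * ‖A - C‖) := by
    rw [inv_mul_eq_div, le_div_iff₀' hη]
    exact h2.trans ((norm_sub_le _ _).trans (by gcongr))
  calc ‖r - r₀‖ = ‖(r - (r₀ - d)) - d‖ := by congr 1; abel
    _ ≤ ‖r - (r₀ - d)‖ + ‖d‖ := norm_sub_le _ _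
    _ ≤ _ := add_le_add h5 hd1

end KBR

namespace KBR

/-! ### Mean-square concentration of empirical operators -/

section Concentration

variable {Ω S : Type*} [MeasurableSpace Ω] [MeasurableSpace S] {Pr : Measure Ω} {μ : Measure S}
  {D : ℕ → Ω → S}

theorem lintegral_enorm_average_sub_sq_le (hlaw : ∀ i, HasLaw (D i) μ Pr) (hindep : iIndepFun D Pr)
    [IsProbabilityMeasure μ] {g : S → ℝ} (hg : Measurable g) (hg2 : MemLp g 2 μ) {n : ℕ} (hn : 0 < n) :
    ∫⁻ ω, ‖(n : ℝ)⁻¹ * ∑ i ∈ Finset.range n, g (D i ω) - ∫ s, g s ∂μ‖ₑ ^ 2 ∂Pr ≤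
      (n : ℝ≥0∞)⁻¹ * ∫⁻ s, ‖g s‖ₑ ^ 2 ∂μ := by
  have : IsProbabilityMeasure Pr := (hlaw 0).isProbabilityMeasure
  have hX : ∀ i, MemLp (g ∘ D i) 2 Pr := fun i => by
    rw [← memLp_map_measure_iff hg.aestronglyMeasurable (hlaw i).aemeasurable, (hlaw i).map_eq]
    exact hg2
  have hmean : ∀ i, ∫ ω, g (D i ω) ∂Pr = ∫ s, g s ∂μ := fun i =>
    (hlaw i).integral_comp hg.aestronglyMeasurable
  have hvar : ∀ i, Var[g ∘ D i; Pr] ≤ ∫ s, g s ^ 2 ∂μ := fun i => by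
    refine (variance_le_expectation_sq (hX i).aestronglyMeasurable).trans (le_of_eq ?_)
    exact (hlaw i).integral_comp (hg.pow_const 2).aestronglyMeasurable
  have hind : Set.Pairwise (Finset.range n : Set ℕ)
      fun i j => (g ∘ D i) ⟂ᵢ[Pr] (g ∘ D j) := fun i _ j _ hij =>
    (hindep.indepFun hij).comp hg hg
  have hsum := IndepFun.variance_sum (μ := Pr) (s := Finset.range n) (fun i _ => hX i) hind
  set A : Ω → ℝ := fun ω => (n : ℝ)⁻¹ * (∑ i ∈ Finset.range n, g ∘ D i) ω with hA
  have hAL : MemLp A 2 Pr := (memLp_finsetSum' _ fun i _ => hX i).const_mul _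
  have hAm : ∫ ω, A ω ∂Pr = ∫ s, g s ∂μ := by
    simp only [hA, integral_const_mul, Finset.sum_apply]
    rw [integral_finsetSum _ fun i _ => (hX i).integrable (by norm_num)]
    simp only [Function.comp_apply, hmean, Finset.sum_const, Finset.card_range, nsmul_eq_mul]
    field_simp
  have hAv : Var[A; Pr] ≤ (n : ℝ)⁻¹ * ∫ s, g s ^ 2 ∂μ := by
    rw [hA, variance_const_mul, hsum]
    calc _ ≤ ((n : ℝ)⁻¹) ^ 2 * ∑ i ∈ Finset.range n, ∫ s, g s ^ 2 ∂μ := by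
          gcongr
          exact hvar _
      _ = _ := by
          rw [Finset.sum_const, Finset.card_range, nsmul_eq_mul]
          field_simp
  have hev := ofReal_variance hAL
  rw [evariance, hAm] at hev
  calc _ = ∫⁻ ω, ‖A ω - ∫ s, g s ∂μ‖ₑ ^ 2 ∂Pr := by simp [hA]
    _ = ENNReal.ofReal (Var[A; Pr]) := hev.symm
    _ ≤ ENNReal.ofReal ((n : ℝ)⁻¹ * ∫ s, g s ^ 2 ∂μ) := ENNReal.ofReal_le_ofReal hAv
    _ = _ := by
      rw [ENNReal.ofReal_mul (by positivity), ENNReal.ofReal_inv_of_pos (by positivity),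
        ENNReal.ofReal_natCast, ofReal_integral_eq_lintegral_ofReal hg2.integrable_sq
          (ae_of_all _ fun s => sq_nonneg _)]
      congr 1
      refine lintegral_congr fun s => ?_
      rw [← enorm_pow, Real.enorm_of_nonneg (sq_nonneg _)]

variable {E F : Type*} [NormedAddCommGroup E] [InnerProductSpace ℝ E]
  [NormedAddCommGroup F] [InnerProductSpace ℝ F]
  {W : S → ℝ} {a : S → E} {b : S → F} {B : ℝ}

theorem integrable_smul_rankOne [IsFiniteMeasure μ] (hW : StronglyMeasurable W)
    (ha : StronglyMeasurable a)
    (hb : StronglyMeasurable b) (hB : ∀ᵐ s ∂μ, ‖W s‖ * (‖a s‖ * ‖b s‖) ≤ B) :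
    Integrable (fun s => W s • rankOne ℝ (a s) (b s)) μ := by
  refine Integrable.of_bound (C := B) (hW.smul ?_).aestronglyMeasurable ?_
  · have hc : Continuous fun p : E × F => rankOne ℝ p.1 p.2 := by
      refine Continuous.clm_apply ?_ ?_
      all_goals fun_prop
    exact hc.comp_stronglyMeasurable (ha.prodMk hb)
  · filter_upwards [hB] with s hs
    rwa [norm_smul, norm_rankOne]

theorem inner_weightedCov_sub_integral [CompleteSpace E]
    (hint : Integrable (fun s => W s • rankOne ℝ (a s) (b s)) μ)
    (n : ℕ) (x : ℕ → S) (e : F) (f : E) :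
    inner ℝ f ((weightedCov n (fun i => W (x i)) (fun i => a (x i)) (fun i => b (x i)) -
      ∫ s, W s • rankOne ℝ (a s) (b s) ∂μ) e) =
    (n : ℝ)⁻¹ * ∑ i ∈ Finset.range n,
      W (x i) * (inner ℝ f (a (x i)) * inner ℝ (b (x i)) e) -
      ∫ s, W s * (inner ℝ f (a s) * inner ℝ (b s) e) ∂μ := by
  have h1 : inner ℝ f ((∫ s, W s • rankOne ℝ (a s) (b s) ∂μ) e) =
      ∫ s, W s * (inner ℝ f (a s) * inner ℝ (b s) e) ∂μ := by
    have h := ((innerSL ℝ f).comp (ContinuousLinearMap.apply ℝ E e)).integral_comp_comm hint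
    simp only [ContinuousLinearMap.comp_apply, ContinuousLinearMap.apply_apply] at h
    refine h.symm.trans (integral_congr_ae (ae_of_all _ fun s => ?_))
    simp only [smul_apply, rankOne_apply, innerSL_apply_apply, real_inner_smul_right]
    ring
  rw [sub_apply, inner_sub_right, h1]
  congr 1
  simp only [weightedCov, smul_apply, sum_apply, inner_sum, real_inner_smul_right, rankOne_apply]
  congr 1
  refine Finset.sum_congr rfl fun i _ => ?_
  ring

variable [IsProbabilityMeasure μ] [CompleteSpace E] [TopologicalSpace.SeparableSpace E]
  [CompleteSpace F] [TopologicalSpace.SeparableSpace F]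

/-- The squared norm is the double sum of squared matrix coefficients, each a centred scalar average
with variance at most its second moment over `n`. Tonelli and Parseval resum these moments to that
of `‖W‖ ‖a‖ ‖b‖`. -/
theorem lintegral_hsNorm_weightedCov_sub_sq_le (hlaw : ∀ i, HasLaw (D i) μ Pr)
    (hindep : iIndepFun D Pr) (hW : StronglyMeasurable W) (ha : StronglyMeasurable a)
    (hb : StronglyMeasurable b) (hB : ∀ᵐ s ∂μ, ‖W s‖ * (‖a s‖ * ‖b s‖) ≤ B) :
    (∀ n : ℕ, AEMeasurable (fun ω => hsNorm (weightedCov n (fun i => W (D i ω))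
      (fun i => a (D i ω)) (fun i => b (D i ω)) - ∫ s, W s • rankOne ℝ (a s) (b s) ∂μ)) Pr) ∧
    ∀ n : ℕ, 0 < n → ∫⁻ ω, hsNorm (weightedCov n (fun i => W (D i ω))
      (fun i => a (D i ω)) (fun i => b (D i ω)) - ∫ s, W s • rankOne ℝ (a s) (b s) ∂μ) ^ 2 ∂Pr ≤
      (n : ℝ≥0∞)⁻¹ * ENNReal.ofReal B ^ 2 := by
  obtain ⟨v, c, -⟩ := exists_hilbertBasis ℝ E
  obtain ⟨w, d, -⟩ := exists_hilbertBasis ℝ F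
  have := HilbertBasis.countable_index c
  have := HilbertBasis.countable_index d
  have hint := integrable_smul_rankOne hW ha hb hB
  let g : w → v → S → ℝ := fun e f s => W s * (inner ℝ (c f) (a s) * inner ℝ (b s) (d e))
  have hg : ∀ e f, StronglyMeasurable (g e f) := fun e f =>
    hW.mul ((stronglyMeasurable_const.inner ha).mul (hb.inner stronglyMeasurable_const))
  have hg2 : ∀ e f, MemLp (g e f) 2 μ := fun e f => by
    refine MemLp.of_bound (hg e f).aestronglyMeasurable B ?_
    filter_upwards [hB] with s hs
    refine le_trans ?_ hs
    rw [norm_mul, norm_mul]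
    have h1 := norm_inner_le_norm (𝕜 := ℝ) (c f) (a s)
    have h2 := norm_inner_le_norm (𝕜 := ℝ) (b s) (d e)
    rw [c.orthonormal.1 f, one_mul] at h1
    rw [d.orthonormal.1 e, mul_one] at h2
    gcongr
  have hsq : ∀ (n : ℕ) (ω : Ω), hsNorm (weightedCov n (fun i => W (D i ω))
      (fun i => a (D i ω)) (fun i => b (D i ω)) - ∫ s, W s • rankOne ℝ (a s) (b s) ∂μ) ^ 2 =
      ∑' e, ∑' f, ‖(n : ℝ)⁻¹ * ∑ i ∈ Finset.range n, g e f (D i ω) - ∫ s, g e f s ∂μ‖ₑ ^ 2 := by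
    intro n ω
    rw [hsNorm_sq d]
    refine tsum_congr fun e => ?_
    rw [← tsum_enorm_inner_sq c]
    refine tsum_congr fun f => ?_
    rw [inner_weightedCov_sub_integral hint]
  have hmeas : ∀ (n : ℕ) e f, AEMeasurable (fun ω =>
      ‖(n : ℝ)⁻¹ * ∑ i ∈ Finset.range n, g e f (D i ω) - ∫ s, g e f s ∂μ‖ₑ ^ 2) Pr := by
    intro n e f
    have h : ∀ i, AEMeasurable (fun ω => g e f (D i ω)) Pr := fun i =>
      (hg e f).measurable.comp_aemeasurable (hlaw i).aemeasurable
    exact (((Finset.aemeasurable_fun_sum _ fun i _ => h i).const_mul _).sub_const _).enorm.pow_const _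
  constructor
  · intro n
    have h : AEMeasurable (fun ω => (hsNorm (weightedCov n (fun i => W (D i ω))
      (fun i => a (D i ω)) (fun i => b (D i ω)) -
        ∫ s, W s • rankOne ℝ (a s) (b s) ∂μ) ^ 2) ^ (1 / 2 : ℝ)) Pr := by
      simp only [hsq]
      exact (AEMeasurable.tsum fun e => AEMeasurable.tsum fun f =>
        hmeas n e f).pow_const _
    refine h.congr (ae_of_all _ fun ω => ?_)
    simp only
    rw [← ENNReal.rpow_natCast, ← ENNReal.rpow_mul]
    norm_num
  · intro n hn
    simp only [hsq]
    rw [lintegral_tsum fun e => AEMeasurable.tsum fun f => hmeas n e f]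
    calc _ = ∑' e, ∑' f, ∫⁻ ω, ‖(n : ℝ)⁻¹ * ∑ i ∈ Finset.range n, g e f (D i ω) -
            ∫ s, g e f s ∂μ‖ₑ ^ 2 ∂Pr := by
          refine tsum_congr fun e => ?_
          rw [lintegral_tsum fun f => hmeas n e f]
      _ ≤ ∑' e, ∑' f, (n : ℝ≥0∞)⁻¹ * ∫⁻ s, ‖g e f s‖ₑ ^ 2 ∂μ :=
          ENNReal.tsum_le_tsum fun e => ENNReal.tsum_le_tsum fun f =>
            lintegral_enorm_average_sub_sq_le hlaw hindep (hg e f).measurable (hg2 e f) hn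
      _ = (n : ℝ≥0∞)⁻¹ * ∫⁻ s, (‖W s‖ₑ * (‖a s‖ₑ * ‖b s‖ₑ)) ^ 2 ∂μ := by
          simp only [ENNReal.tsum_mul_left]
          congr 1
          have hm : ∀ e f, AEMeasurable (fun s => ‖g e f s‖ₑ ^ 2) μ := fun e f =>
            ((hg e f).measurable.enorm.pow_const _).aemeasurable
          simp only [← lintegral_tsum (hm _)]
          rw [← lintegral_tsum fun e => AEMeasurable.tsum (hm e)]
          refine lintegral_congr fun s => ?_
          simp only [g, enorm_mul, mul_pow, ENNReal.tsum_mul_left, ENNReal.tsum_mul_right,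
            tsum_enorm_inner_sq c]
          congr 2
          rw [← tsum_enorm_inner_sq d]
          simp_rw [real_inner_comm]
      _ ≤ (n : ℝ≥0∞)⁻¹ * ∫⁻ _, ENNReal.ofReal B ^ 2 ∂μ := by
          gcongr (n : ℝ≥0∞)⁻¹ * ?_
          refine lintegral_mono_ae ?_
          filter_upwards [hB] with s hs
          gcongr
          simp only [← ofReal_norm]
          rw [← ENNReal.ofReal_mul (norm_nonneg _), ← ENNReal.ofReal_mul (norm_nonneg _)]
          exact ENNReal.ofReal_le_ofReal hs
      _ = _ := by simp

/-- Weighted empirical covariance operators of bounded i.i.d. data converge at rate `n ^ (-1/2)` in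
Hilbert-Schmidt norm. -/
theorem isBigOInProb_hsNorm_weightedCov_sub (hlaw : ∀ i, HasLaw (D i) μ Pr)
    (hindep : iIndepFun D Pr) (hW : StronglyMeasurable W) (ha : StronglyMeasurable a)
    (hb : StronglyMeasurable b) (hB : ∀ᵐ s ∂μ, ‖W s‖ * (‖a s‖ * ‖b s‖) ≤ B) :
    IsBigOInProb Pr (fun n ω => hsNorm (weightedCov n (fun i => W (D i ω))
      (fun i => a (D i ω)) (fun i => b (D i ω)) - ∫ s, W s • rankOne ℝ (a s) (b s) ∂μ))
      (fun n => (n : ℝ) ^ (-(1 / 2) : ℝ)) := by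
  have h := lintegral_hsNorm_weightedCov_sub_sq_le hlaw hindep hW ha hb hB
  -- `max B 0` matches the truncation built into `ENNReal.ofReal B`.
  refine IsBigOInProb.of_lintegral_sq h.1 (K := max B 0 ^ 2) ?_ ?_
  · filter_upwards [eventually_gt_atTop 0] with n hn
    positivity
  · filter_upwards [eventually_gt_atTop 0] with n hn
    refine (h.2 n hn).trans (le_of_eq ?_)
    have h1 : ((n : ℝ) ^ (-(1 / 2) : ℝ)) ^ 2 = (n : ℝ)⁻¹ := by
      rw [← Real.rpow_natCast, ← Real.rpow_mul (by positivity)]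
      norm_num [Real.rpow_neg_one]
    rw [h1, mul_comm, ENNReal.ofReal_mul (by positivity), ENNReal.ofReal_pow (by positivity),
      ENNReal.ofReal_inv_of_pos (by positivity), ENNReal.ofReal_natCast]
    congr 2
    rcases le_total 0 B with h0 | h0
    · rw [max_eq_left h0]
    · rw [max_eq_right h0, ENNReal.ofReal_of_nonpos h0, ENNReal.ofReal_zero]

end Concentration

end KBR

namespace KBR

/-! ### Feature maps and the normal equation -/

section Feature

variable {S H : Type*} [NormedAddCommGroup H] [InnerProductSpace ℝ H] [CompleteSpace H]
  [RKHS ℝ H S ℝ]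

theorem inner_feature (x : S) (f : H) : inner ℝ (feature H x) f = f x := by
  simp [feature]

theorem inner_feature_feature (x y : S) :
    inner ℝ (feature H x) (feature H y) = scalarKernel H x y := by
  rw [inner_feature, feature, RKHS.kerFun_apply, scalarKernel]

/-- `‖k_y - k_x‖² = k(y,y) - 2 k(y,x) + k(x,x)` is continuous in `y` and vanishes at `y = x`. -/
theorem continuous_feature [TopologicalSpace S]
    (hk : Continuous fun p : S × S => scalarKernel H p.1 p.2) : Continuous (feature H : S → H) := by
  refine continuous_iff_continuousAt.2 fun x => ?_
  rw [ContinuousAt, tendsto_iff_norm_sub_tendsto_zero]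
  have h2 : Continuous ((fun p : S × S => scalarKernel H p.1 p.2) ∘ fun y : S => (y, y)) :=
    hk.comp (continuous_id.prodMk continuous_id)
  have h3 : Continuous ((fun p : S × S => scalarKernel H p.1 p.2) ∘ fun y : S => (y, x)) :=
    hk.comp (continuous_id.prodMk continuous_const)
  have h1 : Continuous fun y : S => √(scalarKernel H y y - 2 * scalarKernel H y x +
      scalarKernel H x x) :=
    ((h2.sub (h3.const_mul 2)).add continuous_const).sqrt
  have h4 := h1.tendsto x
  rw [show scalarKernel H x x - 2 * scalarKernel H x x + scalarKernel H x x = 0 by ring,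
    Real.sqrt_zero] at h4
  refine h4.congr fun y => ?_
  rw [← inner_feature_feature, ← inner_feature_feature, ← inner_feature_feature,
    real_inner_self_eq_norm_sq, real_inner_self_eq_norm_sq, ← norm_sub_sq_real,
    Real.sqrt_sq (norm_nonneg _)]

theorem stronglyMeasurable_feature [TopologicalSpace S] [MeasurableSpace S]
    [OpensMeasurableSpace S] [TopologicalSpace.SeparableSpace H]
    (hk : Continuous fun p : S × S => scalarKernel H p.1 p.2) :
    StronglyMeasurable (feature H : S → H) := by
  borelize H
  have : SecondCountableTopology H := UniformSpace.secondCountable_of_separable H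
  exact (continuous_feature hk).measurable.stronglyMeasurable

theorem add_smul_kulsif (n : ℕ) (z : ℕ → S) (m : H) {η : ℝ} (hη : 0 < η) :
    (weightedCov n (fun _ => 1) (fun i => feature H (z i)) (fun i => feature H (z i)) :
      H →L[ℝ] H).IsPositive ∧
    weightedCov n (fun _ => 1) (fun i => feature H (z i)) (fun i => feature H (z i))
      (kulsif n z m η) + η • kulsif n z m η = m := by
  have hpos : (weightedCov n (fun _ => 1) (fun i => feature H (z i)) (fun i => feature H (z i)) :
      H →L[ℝ] H).IsPositive := by
    simp only [weightedCov, one_smul]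
    exact (ContinuousLinearMap.isPositive_sum _ fun i _ =>
      InnerProductSpace.isPositive_rankOne_self _).smul_of_nonneg (by positivity)
  refine ⟨hpos, add_smul_eq_of_isMinOn_kulsifLoss hpos hη ?_⟩
  exact Classical.epsilon_spec (existsUnique_isMinOn_kulsifLoss _ hpos m hη).exists

end Feature

/-! ### Covariance operators, change of measure and rates -/

section CovOp

variable {α E : Type*} [MeasurableSpace α] [NormedAddCommGroup E] [InnerProductSpace ℝ E]
  {μ : Measure α} {f : α → E}

theorem covOp_apply (hint : Integrable (fun w => rankOne ℝ (f w) (f w)) μ) (v : E) :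
    covOp μ f f v = ∫ w, (inner ℝ (f w) v : ℝ) • f w ∂μ := by
  rw [covOp, ContinuousLinearMap.integral_apply hint]
  rfl

theorem isPositive_covOp [CompleteSpace E]
    (hint : Integrable (fun w => rankOne ℝ (f w) (f w)) μ) :
    (covOp μ f f).IsPositive := by
  have key : ∀ x y, inner ℝ (covOp μ f f x) y = ∫ w, inner ℝ (f w) x * inner ℝ (f w) y ∂μ := by
    intro x y
    have h : Integrable (fun w => (inner ℝ (f w) x : ℝ) • f w) μ :=
      (ContinuousLinearMap.apply ℝ E x).integrable_comp hint
    rw [covOp_apply hint, real_inner_comm, ← integral_inner h]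
    refine integral_congr_ae (ae_of_all _ fun w => ?_)
    simp only [real_inner_smul_right]
    rw [real_inner_comm y]
  refine (ContinuousLinearMap.isPositive_iff _).2 ⟨fun x y => ?_, fun x => ?_⟩
  · rw [ContinuousLinearMap.coe_coe, key, real_inner_comm, key]
    simp_rw [mul_comm]
  · rw [key]
    exact integral_nonneg fun w => mul_self_nonneg _

end CovOp

theorem abs_max_zero_sub_le {x y : ℝ} (hy : 0 ≤ y) : |max 0 x - y| ≤ |x - y| := by
  rcases le_total 0 x with h | h
  · rw [max_eq_right h]
  · rw [max_eq_left h, abs_of_nonpos (by linarith), abs_of_nonpos (by linarith)]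
    linarith

/-- Replacing the true density ratio by the truncated estimate in a weighted covariance operator
costs at most a multiple of the RKHS error of the estimate. -/
theorem hsNorm_weightedCov_ratioEst_sub_le {S H E F : Type*}
    [NormedAddCommGroup H] [InnerProductSpace ℝ H] [CompleteSpace H] [RKHS ℝ H S ℝ]
    [NormedAddCommGroup E] [InnerProductSpace ℝ E] [CompleteSpace E]
    [NormedAddCommGroup F] [InnerProductSpace ℝ F] [CompleteSpace F]
    (n : ℕ) (z : ℕ → S) (m r₀ : H) (η : ℝ) (a : ℕ → E) (b : ℕ → F) {κ A B : ℝ}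
    (hz : ∀ i, ‖feature H (z i)‖ ≤ κ) (hr₀ : ∀ i, 0 ≤ r₀ (z i)) (ha : ∀ i, ‖a i‖ ≤ A)
    (hb : ∀ i, ‖b i‖ ≤ B) :
    hsNorm (weightedCov n (fun i => ratioEst n z m η (z i)) a b -
      weightedCov n (fun i => r₀ (z i)) a b) ≤
      ENNReal.ofReal (κ * A * B) * ‖kulsif n z m η - r₀‖ₑ := by
  have h1 : weightedCov n (fun i => ratioEst n z m η (z i)) a b -
      weightedCov n (fun i => r₀ (z i)) a b =
      weightedCov n (fun i => ratioEst n z m η (z i) - r₀ (z i)) a b := by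
    simp only [weightedCov, ← smul_sub, ← Finset.sum_sub_distrib, ← sub_smul]
  rw [h1]
  refine hsNorm_weightedCov_le n _ a b _ fun i _ => ?_
  have hκ : 0 ≤ κ := (norm_nonneg _).trans (hz 0)
  have hA : 0 ≤ A := (norm_nonneg _).trans (ha 0)
  have hB : 0 ≤ B := (norm_nonneg _).trans (hb 0)
  have h2 : ‖ratioEst n z m η (z i) - r₀ (z i)‖ ≤ κ * ‖kulsif n z m η - r₀‖ := by
    refine (abs_max_zero_sub_le (hr₀ i)).trans ?_
    rw [← inner_feature, ← inner_feature (z i) r₀, ← inner_sub_right]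
    refine (abs_real_inner_le_norm _ _).trans ?_
    gcongr
    exact hz i
  simp only [← ofReal_norm]
  rw [← ENNReal.ofReal_mul (norm_nonneg _), ← ENNReal.ofReal_mul (norm_nonneg _),
    ← ENNReal.ofReal_mul (by positivity)]
  refine ENNReal.ofReal_le_ofReal ?_
  calc _ ≤ κ * ‖kulsif n z m η - r₀‖ * (A * B) := by
        gcongr
        · exact ha i
        · exact hb i
    _ = _ := by ring

theorem ae_compProd_of_ae_left {α β : Type*} [MeasurableSpace α] [MeasurableSpace β]
    {μ : Measure α} [SFinite μ] (κ : Kernel α β) [IsMarkovKernel κ] {p : α → Prop}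
    (h : ∀ᵐ s ∂μ, p s) : ∀ᵐ w ∂(μ ⊗ₘ κ), p w.1 := by
  refine ae_of_ae_map measurable_fst.aemeasurable ?_
  rwa [← Measure.fst, Measure.fst_compProd]

/-- Both joint laws share the kernel, so their density ratio depends on the first coordinate alone.
-/
theorem integral_smul_compProd_eq_of_rnDeriv {α β G : Type*} [MeasurableSpace α]
    [MeasurableSpace β] [NormedAddCommGroup G] [NormedSpace ℝ G] {μ ν : Measure α}
    [IsFiniteMeasure μ] [IsFiniteMeasure ν] (κ : Kernel α β) [IsMarkovKernel κ] (hac : μ ≪ ν)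
    {r : α → ℝ} (hr : (fun z => (μ.rnDeriv ν z).toReal) =ᵐ[ν] r) (f : α × β → G) :
    ∫ w, r w.1 • f w ∂(ν ⊗ₘ κ) = ∫ w, f w ∂(μ ⊗ₘ κ) := by
  rw [← integral_rnDeriv_smul (hac.compProd_left κ)]
  refine integral_congr_ae ?_
  filter_upwards [ae_compProd_of_ae_left κ hr, rnDeriv_measure_compProd_left μ ν κ] with w h1 h2
  rw [h2, h1]

/-- The lower bound on `η` controls `η⁻¹ n ^ (-α)`, the upper bound controls `η ^ β`, and `α ≤ 1/2`
absorbs the covariance error. -/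
theorem IsBigOInProb.kulsif_rate {Ω : Type*} [MeasurableSpace Ω] {P : Measure Ω}
    {Y M Δ : ℕ → Ω → ℝ≥0∞} {η : ℕ → ℝ} {α β c G : ℝ} (hα : α ∈ Set.Ioc (0 : ℝ) (1 / 2))
    (hβ : 0 < β) (hc : 0 ≤ c) (hG : 0 ≤ G) (hηpos : ∀ᶠ n in atTop, 0 < η n)
    (hη : η =Θ[atTop] fun n : ℕ => (n : ℝ) ^ (-(α / (β + 1))))
    (hM : IsBigOInProb P M fun n => (n : ℝ) ^ (-α))
    (hΔ : IsBigOInProb P Δ fun n => (n : ℝ) ^ (-(1 / 2) : ℝ))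
    (hY : ∀ᶠ n in atTop, ∀ᵐ ω ∂P, Y n ω ≤ ENNReal.ofReal (η n)⁻¹ *
      (M n ω + ENNReal.ofReal c * Δ n ω) + ENNReal.ofReal (η n ^ β * G)) :
    IsBigOInProb P Y fun n => (n : ℝ) ^ (-(α * β / (β + 1))) := by
  have hnn : ∀ s : ℝ, ∀ᶠ n : ℕ in atTop, 0 ≤ (n : ℝ) ^ s := fun s =>
    Eventually.of_forall fun n => by positivity
  -- The multiplier `c + 1` replaces `c` because scaling requires a strictly positive constant.
  have hΔ' : IsBigOInProb P (fun n ω => ENNReal.ofReal (c + 1) * Δ n ω)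
      fun n => (n : ℝ) ^ (-α) := by
    refine (hΔ.ofReal_mul (c := fun _ => c + 1) (Eventually.of_forall fun _ => by positivity)).mono_rate
      (K := c + 1) (by positivity) ?_
    filter_upwards [eventually_ge_atTop 1] with n hn
    have : (1 : ℝ) ≤ n := by exact_mod_cast hn
    gcongr
    exact hα.2
  have h1 := (hM.add hΔ' (hnn _)).ofReal_mul (c := fun n => (η n)⁻¹)
    (hηpos.mono fun n hn => inv_pos.2 hn)
  obtain ⟨K₁, hK₁, hη₁⟩ := hη.1.exists_pos
  obtain ⟨K₂, hK₂, hη₂⟩ := hη.2.exists_pos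
  have h2 : IsBigOInProb P (fun n ω => ENNReal.ofReal (η n)⁻¹ *
      (M n ω + ENNReal.ofReal (c + 1) * Δ n ω)) fun n => (n : ℝ) ^ (-(α * β / (β + 1))) := by
    refine h1.mono_rate hK₂ ?_
    filter_upwards [hηpos, hη₂.bound, eventually_gt_atTop 0] with n hn hn2 hn0
    have hn0' : (0 : ℝ) < n := by exact_mod_cast hn0
    rw [Real.norm_of_nonneg hn.le, Real.norm_of_nonneg (by positivity)] at hn2
    rw [inv_mul_eq_div, div_le_iff₀ hn]
    calc (n : ℝ) ^ (-α) = (n : ℝ) ^ (-(α * β / (β + 1))) * (n : ℝ) ^ (-(α / (β + 1))) := by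
          rw [← Real.rpow_add hn0']
          congr 1
          field_simp
          ring
      _ ≤ (n : ℝ) ^ (-(α * β / (β + 1))) * (K₂ * η n) := by gcongr
      _ = _ := by ring
  have h3 : IsBigOInProb P (fun n _ => ENNReal.ofReal (η n ^ β * G))
      fun n => (n : ℝ) ^ (-(α * β / (β + 1))) := by
    refine (IsBigOInProb.const fun n => η n ^ β * G).mono_rate (K := K₁ ^ β * G + 1)
      (by positivity) ?_
    filter_upwards [hηpos, hη₁.bound] with n hn hn1
    rw [Real.norm_of_nonneg hn.le, Real.norm_of_nonneg (by positivity)] at hn1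
    calc η n ^ β * G ≤ (K₁ * (n : ℝ) ^ (-(α / (β + 1)))) ^ β * G := by gcongr
      _ = K₁ ^ β * G * (n : ℝ) ^ (-(α * β / (β + 1))) := by
          rw [Real.mul_rpow hK₁.le (by positivity), ← Real.rpow_mul (by positivity)]
          rw [show -(α / (β + 1)) * β = -(α * β / (β + 1)) by ring]
          ring
      _ ≤ _ := by gcongr; linarith
  refine (h2.add h3 (hnn _)).mono ?_
  filter_upwards [hY] with n hn
  filter_upwards [hn] with ω hω
  refine hω.trans ?_
  gcongr
  linarith

theorem IsBigOInProb.enorm_of_hsNorm {Ω E F : Type*} [MeasurableSpace Ω] {P : Measure Ω}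
    [NormedAddCommGroup E] [InnerProductSpace ℝ E] [CompleteSpace E]
    [NormedAddCommGroup F] [InnerProductSpace ℝ F] [CompleteSpace F] {A : ℕ → Ω → E →L[ℝ] F}
    {r : ℕ → ℝ} (h : IsBigOInProb P (fun n ω => hsNorm (A n ω)) r) :
    IsBigOInProb P (fun n ω => ‖A n ω‖ₑ) r :=
  h.mono (Eventually.of_forall fun _ => ae_of_all _ fun _ => enorm_le_hsNorm _)

/-- Weighting by the truncated density ratio estimate turns covariance operators under
`PZ ⊗ₘ lik` into covariance operators under `Prior ⊗ₘ lik`, at the rate of the estimate. -/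
theorem isBigOInProb_hsNorm_weightedCov_ratioEst_sub {𝒳 𝒵 H E F Ω : Type*}
    [MeasurableSpace 𝒳] [MeasurableSpace 𝒵] [MeasurableSpace Ω]
    [NormedAddCommGroup H] [InnerProductSpace ℝ H] [CompleteSpace H] [RKHS ℝ H 𝒵 ℝ]
    [NormedAddCommGroup E] [InnerProductSpace ℝ E] [CompleteSpace E]
    [TopologicalSpace.SeparableSpace E]
    [NormedAddCommGroup F] [InnerProductSpace ℝ F] [CompleteSpace F]
    [TopologicalSpace.SeparableSpace F]
    {Pr : Measure Ω} {PZ Prior : Measure 𝒵} [IsProbabilityMeasure PZ] [IsProbabilityMeasure Prior]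
    {lik : Kernel 𝒵 𝒳} [IsMarkovKernel lik] {κ A B : ℝ}
    (hκ : ∀ᵐ z ∂PZ, ‖feature H z‖ ≤ κ) {r₀ : H} (hac : Prior ≪ PZ)
    (hr₀ : (fun z => (Prior.rnDeriv PZ z).toReal) =ᵐ[PZ] fun z => r₀ z)
    (hr₀m : StronglyMeasurable fun z => r₀ z)
    {Z : ℕ → Ω → 𝒵} {X : ℕ → Ω → 𝒳}
    (hlaw : ∀ i, HasLaw (fun ω => (Z i ω, X i ω)) (PZ ⊗ₘ lik) Pr)
    (hindep : iIndepFun (fun i ω => (Z i ω, X i ω)) Pr)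
    {a : 𝒵 × 𝒳 → E} {b : 𝒵 × 𝒳 → F} (ham : StronglyMeasurable a) (hbm : StronglyMeasurable b)
    (ha : ∀ᵐ w ∂(PZ ⊗ₘ lik), ‖a w‖ ≤ A) (hb : ∀ᵐ w ∂(PZ ⊗ₘ lik), ‖b w‖ ≤ B)
    {mHat : ℕ → Ω → H} {η rate : ℕ → ℝ} (hrate₀ : ∀ n, 0 ≤ rate n)
    (hrate : ∀ᶠ n : ℕ in atTop, (n : ℝ) ^ (-(1 / 2) : ℝ) ≤ rate n)
    (hkulsif : IsBigOInProb Pr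
      (fun n ω => ‖kulsif n (fun i => Z i ω) (mHat n ω) (η n) - r₀‖ₑ) rate) :
    IsBigOInProb Pr (fun n ω => hsNorm (weightedCov n
      (fun i => ratioEst n (fun i => Z i ω) (mHat n ω) (η n) (Z i ω))
      (fun i => a (Z i ω, X i ω)) (fun i => b (Z i ω, X i ω)) -
      covOp (Prior ⊗ₘ lik) a b)) rate := by
  have hr₀nn : ∀ᵐ s ∂PZ, 0 ≤ r₀ s := by
    filter_upwards [hr₀] with s hs
    rw [← hs]
    exact ENNReal.toReal_nonneg
  have hdata : ∀ᵐ ω ∂Pr, ∀ i, ‖feature H (Z i ω)‖ ≤ κ ∧ 0 ≤ r₀ (Z i ω) ∧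
      ‖a (Z i ω, X i ω)‖ ≤ A ∧ ‖b (Z i ω, X i ω)‖ ≤ B := by
    refine ae_all_iff.2 fun i => ?_
    have h : ∀ᵐ w ∂(PZ ⊗ₘ lik), ‖feature H w.1‖ ≤ κ ∧ 0 ≤ r₀ w.1 ∧ ‖a w‖ ≤ A ∧ ‖b w‖ ≤ B := by
      filter_upwards [ae_compProd_of_ae_left lik hκ, ae_compProd_of_ae_left lik hr₀nn, ha, hb]
        with w h1 h2 h3 h4
      exact ⟨h1, h2, h3, h4⟩
    rw [← (hlaw i).map_eq] at h
    exact ae_of_ae_map (hlaw i).aemeasurable h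
  have hB : ∀ᵐ w ∂(PZ ⊗ₘ lik), ‖r₀ w.1‖ * (‖a w‖ * ‖b w‖) ≤ ‖r₀‖ * κ * (A * B) := by
    filter_upwards [ae_compProd_of_ae_left lik hκ, ha, hb] with w h1 h2 h3
    have h4 : ‖r₀ w.1‖ ≤ ‖r₀‖ * κ := by
      rw [← inner_feature]
      refine (norm_inner_le_norm _ _).trans ?_
      rw [mul_comm]
      gcongr
    have := (norm_nonneg _).trans h4
    have := (norm_nonneg _).trans h2
    gcongr
  have h1 := isBigOInProb_hsNorm_weightedCov_sub hlaw hindep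
    (W := fun w : 𝒵 × 𝒳 => r₀ w.1) (hr₀m.comp_measurable measurable_fst) ham hbm hB
  rw [integral_smul_compProd_eq_of_rnDeriv lik hac hr₀] at h1
  set K : ℝ := |κ * A * B| + 1 with hK
  have hKpos : 0 < K := by positivity
  have h2 := (hkulsif.ofReal_mul (c := fun _ => K) (Eventually.of_forall fun _ => hKpos)).mono_rate
    (a' := rate) hKpos (Eventually.of_forall fun _ => le_rfl)
  refine (h2.add (h1.mono_rate one_pos (by simpa using hrate))
    (Eventually.of_forall hrate₀)).mono (Eventually.of_forall fun n => ?_)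
  filter_upwards [hdata] with ω hω
  have h3 := hsNorm_weightedCov_ratioEst_sub_le n (fun i => Z i ω) (mHat n ω) r₀ (η n)
    (fun i => a (Z i ω, X i ω)) (fun i => b (Z i ω, X i ω)) (fun i => (hω i).1)
    (fun i => (hω i).2.1) (fun i => (hω i).2.2.1) (fun i => (hω i).2.2.2)
  -- Intermediate operator: the same sample, weighted by the true ratio.
  rw [← sub_add_sub_cancel _ (weightedCov n (fun i => r₀ (Z i ω))
    (fun i => a (Z i ω, X i ω)) (fun i => b (Z i ω, X i ω)))]
  refine (hsNorm_add_le _ _).trans (add_le_add (h3.trans ?_) le_rfl)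
  gcongr
  rw [hK]
  linarith [le_abs_self (κ * A * B)]

end KBR

/-! ### Assembly of the rates -/

theorem mainTheorem3
    {𝒳 𝒵 HX HZ Ω : Type*}
    [TopologicalSpace 𝒳] [MeasurableSpace 𝒳] [OpensMeasurableSpace 𝒳]
    [TopologicalSpace 𝒵] [MeasurableSpace 𝒵] [OpensMeasurableSpace 𝒵]
    [NormedAddCommGroup HX] [InnerProductSpace ℝ HX] [CompleteSpace HX]
    [TopologicalSpace.SeparableSpace HX] [RKHS ℝ HX 𝒳 ℝ]
    [NormedAddCommGroup HZ] [InnerProductSpace ℝ HZ] [CompleteSpace HZ]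
    [TopologicalSpace.SeparableSpace HZ] [RKHS ℝ HZ 𝒵 ℝ]
    [MeasurableSpace Ω] (Pr : Measure Ω) [IsProbabilityMeasure Pr]
    -- marginal law of `Z` under `P`, prior, and the common likelihood
    (PZ Prior : Measure 𝒵) [IsProbabilityMeasure PZ] [IsProbabilityMeasure Prior]
    (lik : Kernel 𝒵 𝒳) [IsMarkovKernel lik]
    -- continuous, almost surely bounded kernels
    (hkX : Continuous fun p : 𝒳 × 𝒳 => KBR.scalarKernel HX p.1 p.2)
    (hkZ : Continuous fun p : 𝒵 × 𝒵 => KBR.scalarKernel HZ p.1 p.2)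
    (κ₁ κ₂ : ℝ)
    (hκ₁ : ∀ᵐ z ∂PZ, ‖KBR.feature HZ z‖ ≤ κ₁)
    (hκ₂ : ∀ᵐ w ∂(PZ ⊗ₘ lik), ‖KBR.feature HX w.2‖ ≤ κ₂)
    -- the density ratio lies in the RKHS and satisfies the source condition
    (r₀ : HZ) (hac : Prior ≪ PZ)
    (hr₀ : (fun z => (Prior.rnDeriv PZ z).toReal) =ᵐ[PZ] fun z => r₀ z)
    (β₁ ζ₁ : ℝ) (hβ₁ : β₁ ∈ Set.Ioc (0 : ℝ) (1 / 2))
    (hsource : ∃ g₁ : HZ, ‖g₁‖ ≤ ζ₁ ∧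
      r₀ = KBR.spectralPow (KBR.covOp PZ (KBR.feature HZ) (KBR.feature HZ)) β₁ g₁)
    -- i.i.d. data from `P`
    (Z : ℕ → Ω → 𝒵) (X : ℕ → Ω → 𝒳)
    (hlaw : ∀ i, HasLaw (fun ω => (Z i ω, X i ω)) (PZ ⊗ₘ lik) Pr)
    (hindep : iIndepFun (fun i ω => (Z i ω, X i ω)) Pr)
    -- estimated prior embedding
    (α₁ : ℝ) (hα₁ : α₁ ∈ Set.Ioc (0 : ℝ) (1 / 2))
    (mHat : ℕ → Ω → HZ)
    (hmHat : KBR.IsBigOInProb Pr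
      (fun n ω => ‖mHat n ω - ∫ z, KBR.feature HZ z ∂Prior‖ₑ)
      (fun n => (n : ℝ) ^ (-α₁)))
    -- regularization
    (η : ℕ → ℝ) (hηpos : ∀ᶠ n in atTop, 0 < η n)
    (hη : η =Θ[atTop] fun n : ℕ => (n : ℝ) ^ (-(α₁ / (β₁ + 1)))) :
    let z : Ω → ℕ → 𝒵 := fun ω i => Z i ω
    let ψ : Ω → ℕ → HX := fun ω i => KBR.feature HX (X i ω)
    let φ : Ω → ℕ → HZ := fun ω i => KBR.feature HZ (Z i ω)
    let rHat : ℕ → Ω → ℕ → ℝ := fun n ω i =>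
      KBR.ratioEst n (z ω) (mHat n ω) (η n) (Z i ω)
    let CXXHat : ℕ → Ω → HX →L[ℝ] HX := fun n ω =>
      KBR.weightedCov n (rHat n ω) (ψ ω) (ψ ω)
    let CXZHat : ℕ → Ω → HZ →L[ℝ] HX := fun n ω =>
      KBR.weightedCov n (rHat n ω) (ψ ω) (φ ω)
    let CXX : HX →L[ℝ] HX := KBR.covOp (Prior ⊗ₘ lik)
      (fun w => KBR.feature HX w.2) (fun w => KBR.feature HX w.2)
    let CXZ : HZ →L[ℝ] HX := KBR.covOp (Prior ⊗ₘ lik)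
      (fun w => KBR.feature HX w.2) (fun w => KBR.feature HZ w.1)
    let rate : ℕ → ℝ := fun n => (n : ℝ) ^ (-(α₁ * β₁ / (β₁ + 1)))
    KBR.IsBigOInProb Pr (fun n ω => KBR.hsNorm (CXXHat n ω - CXX)) rate ∧
    KBR.IsBigOInProb Pr (fun n ω => ‖CXXHat n ω - CXX‖ₑ) rate ∧
    KBR.IsBigOInProb Pr (fun n ω => KBR.hsNorm (CXZHat n ω - CXZ)) rate ∧
    KBR.IsBigOInProb Pr (fun n ω => ‖CXZHat n ω - CXZ‖ₑ) rate := by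
  intro z ψ φ rHat CXXHat CXZHat CXX CXZ rate
  have hφm : StronglyMeasurable (KBR.feature HZ : 𝒵 → HZ) := KBR.stronglyMeasurable_feature hkZ
  have hψm : StronglyMeasurable (KBR.feature HX : 𝒳 → HX) := KBR.stronglyMeasurable_feature hkX
  have hr₀m : StronglyMeasurable fun s => r₀ s := by
    simp only [← KBR.inner_feature]
    exact hφm.inner stronglyMeasurable_const
  have hfst : (PZ ⊗ₘ lik).map Prod.fst = PZ := by
    rw [← Measure.fst, Measure.fst_compProd]
  have hlawZ : ∀ i, HasLaw (Z i) PZ Pr := fun i =>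
    HasLaw.comp (X := fun ω => (Z i ω, X i ω)) ⟨measurable_fst.aemeasurable, hfst⟩ (hlaw i)
  have hindepZ : iIndepFun Z Pr := hindep.comp (fun _ => Prod.fst) fun _ => measurable_fst
  obtain ⟨g, -, hg⟩ := hsource
  have hBZ : ∀ᵐ s ∂PZ, ‖(1 : ℝ)‖ * (‖KBR.feature HZ s‖ * ‖KBR.feature HZ s‖) ≤ κ₁ * κ₁ := by
    filter_upwards [hκ₁] with s hs
    have := (norm_nonneg _).trans hs
    rw [norm_one, one_mul]
    gcongr
  have hint : Integrable (fun s => rankOne ℝ (KBR.feature HZ s) (KBR.feature HZ s)) PZ := by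
    simpa using KBR.integrable_smul_rankOne (W := fun _ => (1 : ℝ)) stronglyMeasurable_const
      hφm hφm hBZ
  have hΔ := KBR.isBigOInProb_hsNorm_weightedCov_sub hlawZ hindepZ (W := fun _ => (1 : ℝ))
    stronglyMeasurable_const hφm hφm hBZ
  simp only [one_smul] at hΔ
  have hC := KBR.isPositive_covOp hint
  -- The reproducing property turns `C r₀` into the `P`-mean of `r₀(Z) φ(Z)`, which is the prior
  -- mean of `φ`.
  have hmean : KBR.covOp PZ (KBR.feature HZ) (KBR.feature HZ) r₀ =
      ∫ s, KBR.feature HZ s ∂Prior := by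
    rw [KBR.covOp_apply hint, ← integral_rnDeriv_smul hac]
    refine integral_congr_ae ?_
    filter_upwards [hr₀] with s hs
    rw [KBR.inner_feature, hs]
  have hkulsif : KBR.IsBigOInProb Pr
      (fun n ω => ‖KBR.kulsif n (z ω) (mHat n ω) (η n) - r₀‖ₑ) rate := by
    refine KBR.IsBigOInProb.kulsif_rate hα₁ hβ₁.1 (c := 2 * ‖r₀‖) (G := ‖g‖) (by positivity)
      (by positivity) hηpos hη hmHat hΔ ?_
    filter_upwards [hηpos] with n hn
    refine ae_of_all _ fun ω => ?_
    obtain ⟨hA, hr⟩ := KBR.add_smul_kulsif n (z ω) (mHat n ω) hn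
    have h := KBR.norm_sub_le_of_source hA hC hn hβ₁.1.le (hβ₁.2.trans (by norm_num)) hg hr
    rw [← ofReal_norm]
    refine (ENNReal.ofReal_le_ofReal h).trans ?_
    rw [ENNReal.ofReal_add (by positivity) (by positivity), ENNReal.ofReal_mul (by positivity),
      ENNReal.ofReal_add (by positivity) (by positivity), ENNReal.ofReal_mul (by positivity),
      ofReal_norm, ofReal_norm (_ - _), hmean]
    gcongr
    exact KBR.enorm_le_hsNorm _
  -- Sampling error is no larger than the target rate, since `αβ/(β+1) ≤ α ≤ 1/2`.
  have hrate : ∀ᶠ n : ℕ in atTop, (n : ℝ) ^ (-(1 / 2) : ℝ) ≤ rate n := by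
    filter_upwards [eventually_ge_atTop 1] with n hn
    have hn' : (1 : ℝ) ≤ n := by exact_mod_cast hn
    refine Real.rpow_le_rpow_of_exponent_le hn' (neg_le_neg ?_)
    have h1 : α₁ * β₁ / (β₁ + 1) ≤ α₁ := by
      rw [div_le_iff₀ (by linarith [hβ₁.1])]
      nlinarith [hα₁.1, hβ₁.1]
    exact h1.trans hα₁.2
  have hrate₀ : ∀ n, 0 ≤ rate n := fun n => by positivity
  have hφκ := KBR.ae_compProd_of_ae_left lik hκ₁
  have hφm' := hφm.comp_measurable (measurable_fst : Measurable (Prod.fst : 𝒵 × 𝒳 → 𝒵))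
  have hψm' := hψm.comp_measurable (measurable_snd : Measurable (Prod.snd : 𝒵 × 𝒳 → 𝒳))
  have hXX : KBR.IsBigOInProb Pr (fun n ω => KBR.hsNorm (CXXHat n ω - CXX)) rate :=
    KBR.isBigOInProb_hsNorm_weightedCov_ratioEst_sub hκ₁ hac hr₀ hr₀m hlaw hindep hψm' hψm'
      hκ₂ hκ₂ hrate₀ hrate hkulsif
  have hXZ : KBR.IsBigOInProb Pr (fun n ω => KBR.hsNorm (CXZHat n ω - CXZ)) rate :=
    KBR.isBigOInProb_hsNorm_weightedCov_ratioEst_sub hκ₁ hac hr₀ hr₀m hlaw hindep hψm' hφm'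
      hκ₂ hφκ hrate₀ hrate hkulsif
  exact ⟨hXX, hXX.enorm_of_hsNorm, hXZ, hXZ.enorm_of_hsNorm⟩
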